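/- For an integer $M\ge 1$ let $\Lambda=\{\lambda\in\mathbb{R}^M:\lambda_j\ge 0,\ \sum_{j=1}^M\lambda_j=1\}$, and for $\rho>0$ let $\mathrm{Diri}(\rho,\ldots,\rho)$ be the symmetric Dirichlet distribution on $\Lambda$, with density $\Gamma(M\rho)\Gamma(\rho)^{-M}\prod_{j=1}^M\lambda_j^{\rho-1}$ with respect to $d\lambda_1\cdots d\lambda_{M-1}$. For $s\in\{1,\ldots,M\}$ and $\epsilon>0$ let $\mathcal{F}^{\Lambda}_{s,\epsilon}=\{\lambda\in\Lambda:\sum_{j=s+1}^M\lambda_{(j)}\le\epsilon\}$, where $\lambda_{(1)}\ge\cdots\ge\lambda_{(M)}$ are the ordered components of $\lambda$. Let $\|\lambda\|_0$ be the number of nonzero components of $\lambda$. For $\alpha>0$ and $\gamma>1$ write $P$ for the probability under $\lambda\sim\mathrm{Diri}(\rho,\ldots,\rho)$ with $\rho=\alpha/M^{\gamma}$. (1) For every $\alpha>0$ there are constants $C,c>0$, depending only on $\alpha$, such that for all $\gamma>1$, all $M\ge 1$, all $s$, all $\lambda^*\in\Lambda$ with $\|\lambda^*\|_0=s$ and all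 $\epsilon\in(0,1)$, $$P(\|\lambda-\lambda^*\|_2\le\epsilon)\ \ge\ c\,\exp\Big\{-C\gamma s\log\frac{M}{\epsilon}\Big\}.$$ (2) For every $\epsilon_0\in(0,1)$ and $\kappa\ge 0$ there is a constant $C>0$, depending only on $\epsilon_0$ and $\kappa$, such that for all $\alpha>0$ and $\gamma>1$ there is a constant $K>0$ (depending only on $\epsilon_0,\kappa,\alpha,\gamma$) such that for all $M\ge 1$, all $s\in\{1,\ldots,M\}$ and all $\epsilon$ with $\epsilon_0M^{-\kappa}\le\epsilon<1$, $$P(\lambda\notin\mathcal{F}^{\Lambda}_{s,\epsilon})\ \le\ K\,\exp\Big\{-C(\gamma-1)s\log\frac{M}{\epsilon}\Big\}.$$ In particular (take $\kappa=0$, $\epsilon_0=\epsilon$), for every fixed $\epsilon\in(0,1)$ this bound holds for all $M$ and $s$, with constants that do not depend on $M$ and $s$. -/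

import Mathlib

open MeasureTheory

/-- Density of the Dirichlet distribution with concentration parameters `a`: on the simplex
`{l | l j ≥ 0, ∑ j, l j = 1}` it is `Γ(∑ a j) / ∏ Γ(a j) * ∏ (l j) ^ (a j - 1)`,
and it is `0` elsewhere. -/
noncomputable def dirichletPDF {M : ℕ} (a : Fin M → ℝ) : (Fin M → ℝ) → ℝ :=
  (stdSimplex ℝ (Fin M)).indicator fun l =>
    Real.Gamma (∑ j, a j) / (∏ j, Real.Gamma (a j)) * ∏ j, l j ^ (a j - 1)

/-- The parametrization `(x₁, …, xₙ) ↦ (x₁, …, xₙ, 1 - x₁ - ⋯ - xₙ)` of the hyperplane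
`{l | ∑ j, l j = 1}` by its first `n` coordinates. -/
def simplexParam {n : ℕ} (x : Fin n → ℝ) : Fin (n + 1) → ℝ :=
  Fin.snoc (α := fun _ => ℝ) x (1 - ∑ i, x i)

/-- The Dirichlet distribution with concentration parameters `a`, as a measure on `Fin M → ℝ`
carried by the simplex. The density is with respect to Lebesgue measure `dl₁ ⋯ dl_{M-1}` in the
first `M - 1` coordinates. For `M = 0` the simplex is empty, and the value is the zero measure. -/
noncomputable def dirichletMeasure : {M : ℕ} → (Fin M → ℝ) → Measure (Fin M → ℝ)
  | 0, _ => 0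
  | n + 1, a =>
    Measure.map simplexParam
      ((volume : Measure (Fin n → ℝ)).withDensity fun x =>
        ENNReal.ofReal (dirichletPDF a (simplexParam x)))

/-- The symmetric Dirichlet distribution `Diri(ρ, …, ρ)` on `Fin M → ℝ`. -/
noncomputable def symmDirichlet (M : ℕ) (ρ : ℝ) : Measure (Fin M → ℝ) :=
  dirichletMeasure fun _ : Fin M => ρ

/-- The number of nonzero components of a vector. -/
noncomputable def l0norm {M : ℕ} (l : Fin M → ℝ) : ℕ :=
  (Function.support l).ncard

/-- The ordered values `l₍₁₎ ≥ l₍₂₎ ≥ ⋯ ≥ l₍M₎` of a vector, with indices starting at `0`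
(`Tuple.sort` sorts increasingly, and `Fin.rev` reverses the order). -/
noncomputable def orderedDesc {M : ℕ} (l : Fin M → ℝ) (j : Fin M) : ℝ :=
  l (Tuple.sort l j.rev)

/-- The `ε`-approximately `s`-sparse vectors of the simplex: the sum of all components except the
`s` largest ones is at most `ε`. -/
def approxSparse (M s : ℕ) (ε : ℝ) : Set (Fin M → ℝ) :=
  {l | l ∈ stdSimplex ℝ (Fin M) ∧
    ∑ j ∈ Finset.univ.filter (fun j : Fin M => s ≤ (j : ℕ)), orderedDesc l j ≤ ε}

/-! Both bounds rest on `Γ(x) = Γ(x + 1) / x`: near `0` every `1 / Γ(ρ)` is worth a factor `ρ`, and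
the proof counts these factors, with `M * ρ = α * M ^ (1 - γ) ≤ α`.

Sparsity bound: a point of the simplex that is not approximately sparse has `s + 1` coordinates
above `ε / M`. For a fixed set `S` of `s + 1` coordinates, apply Markov to `∏ j ∈ S, l j ^ b`.
Multiplying a Dirichlet density by this product gives, up to constants, the Dirichlet density with
parameters raised by `b` on `S`, so the moment is at most a ratio of normalizing constants, of order
`ρ ^ (s + 1) / (M * ρ)`. A union over at most `M ^ (s + 1)` sets leaves `(M * ρ) ^ s * (M / ε) ^ (b
* (s + 1))`, up to constants to the power `s`. Since `log (M / ε)` is at most a multiple of `log M`,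
a small `b` proportional to `γ - 1` keeps a negative power of `M / ε`, with a margin that absorbs
the constants.

Small-ball bound: by symmetry the last coordinate of the centre, the one determined by the others,
is at least `1 / M`. A box of side `d = ε / (4 * M ^ 2)` in the other coordinates then stays in the
ball. A zero coordinate contributes `d ^ ρ / ρ`, whose `1 / ρ` cancels the `ρ` from `1 / Γ(ρ)`; only
the `s - 1` other nonzero coordinates cost a factor `ρ * d ^ A`, `A = max α 1`. The factors `d ^ ρ`
together cost at most `d ^ α`.

Of the Dirichlet integral only the upper bound is needed, that is, total mass at most `1`. -/

/-! ### Power densities and the Dirichlet integral -/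

/-- The density `x ^ (a - 1)` on `[0, ∞)`, extended by `0`. -/
noncomputable def powDensity (a : ℝ) : ℝ → ENNReal :=
  (Set.Ici 0).indicator fun x => ENNReal.ofReal (x ^ (a - 1))

@[fun_prop]
lemma measurable_powDensity (a : ℝ) : Measurable (powDensity a) :=
  Measurable.indicator (by fun_prop) measurableSet_Ici

lemma powDensity_of_nonneg {a x : ℝ} (hx : 0 ≤ x) :
    powDensity a x = ENNReal.ofReal (x ^ (a - 1)) := by
  simp [powDensity, hx]

lemma powDensity_of_neg {a x : ℝ} (hx : x < 0) : powDensity a x = 0 := by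
  simp [powDensity, hx]

lemma powDensity_mul {a u : ℝ} (hu : 0 < u) (x : ℝ) :
    powDensity a (u * x) = ENNReal.ofReal (u ^ (a - 1)) * powDensity a x := by
  rcases lt_or_ge x 0 with hx | hx
  · rw [powDensity_of_neg hx, powDensity_of_neg (mul_neg_of_pos_of_neg hu hx), mul_zero]
  · rw [powDensity_of_nonneg hx, powDensity_of_nonneg (by positivity),
      Real.mul_rpow hu.le hx, ENNReal.ofReal_mul (by positivity)]

lemma lintegral_eq_ofReal_mul_lintegral_comp_mul_left {u : ℝ} (hu : 0 < u) {f : ℝ → ENNReal}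
    (hf : Measurable f) : ∫⁻ x, f x = ENNReal.ofReal u * ∫⁻ x, f (u * x) := by
  rw [← lintegral_map (f := f) hf (measurable_const_mul u), Real.map_volume_mul_left hu.ne',
    lintegral_smul_measure, smul_eq_mul, ← mul_assoc, ← ENNReal.ofReal_mul hu.le,
    abs_of_pos (inv_pos.2 hu), mul_inv_cancel₀ hu.ne', ENNReal.ofReal_one, one_mul]

lemma lintegral_powDensity_mul_powDensity_one_sub {a b : ℝ} (ha : 0 < a) (hb : 0 < b) :
    ∫⁻ x, powDensity a x * powDensity b (1 - x) =
      ENNReal.ofReal (ProbabilityTheory.beta a b) := by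
  have hB := ProbabilityTheory.beta_pos ha hb
  have h : ∀ᵐ x : ℝ, powDensity a x * powDensity b (1 - x) =
      ENNReal.ofReal (ProbabilityTheory.beta a b) * ProbabilityTheory.betaPDF a b x := by
    have h0 : ∀ᵐ x : ℝ, x ≠ 0 := by simp [ae_iff]
    have h1 : ∀ᵐ x : ℝ, x ≠ 1 := by simp [ae_iff]
    filter_upwards [h0, h1] with x hx0 hx1
    rcases lt_or_ge x 0 with hx | hx
    · rw [powDensity_of_neg hx, ProbabilityTheory.betaPDF_eq_zero_of_nonpos hx.le]; simp
    rcases lt_or_ge 1 x with hx' | hx'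
    · rw [powDensity_of_neg (by linarith : 1 - x < 0),
        ProbabilityTheory.betaPDF_eq_zero_of_one_le hx'.le]; simp
    have hx0' := lt_of_le_of_ne hx (Ne.symm hx0)
    have hx1' := lt_of_le_of_ne hx' hx1
    rw [ProbabilityTheory.betaPDF_of_pos_lt_one hx0' hx1', powDensity_of_nonneg hx,
      powDensity_of_nonneg (by linarith), ← ENNReal.ofReal_mul (by positivity),
      ← ENNReal.ofReal_mul hB.le]
    congr 1
    field_simp
  rw [lintegral_congr_ae h, lintegral_const_mul' _ _ ENNReal.ofReal_ne_top,
    ProbabilityTheory.lintegral_betaPDF_eq_one ha hb, mul_one]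

/-- Scaling by `u` reduces to the beta integral. Equality can fail at `u = 0`: if `a + b = 1` the
right side contains `0 ^ 0 = 1` while the integral vanishes. -/
lemma lintegral_powDensity_mul_powDensity_sub_le {a b : ℝ} (ha : 0 < a) (hb : 0 < b) (u : ℝ) :
    ∫⁻ x, powDensity a x * powDensity b (u - x) ≤
      ENNReal.ofReal (ProbabilityTheory.beta a b) * powDensity (a + b) u := by
  rcases le_or_gt u 0 with hu | hu
  · have h0 : ∀ᵐ x : ℝ, x ≠ 0 := by simp [ae_iff]
    have : ∫⁻ x, powDensity a x * powDensity b (u - x) = 0 := by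
      rw [lintegral_eq_zero_iff (by fun_prop)]
      filter_upwards [h0] with x hx
      rcases lt_or_ge x 0 with hx' | hx'
      · simp [powDensity_of_neg hx']
      · have := lt_of_le_of_ne hx' (Ne.symm hx)
        simp [powDensity_of_neg (by linarith : u - x < 0)]
    rw [this]; exact zero_le
  · rw [lintegral_eq_ofReal_mul_lintegral_comp_mul_left hu (by fun_prop)]
    have h : ∀ x, powDensity a (u * x) * powDensity b (u - u * x) =
        ENNReal.ofReal (u ^ (a - 1) * u ^ (b - 1)) * (powDensity a x * powDensity b (1 - x)) := by
      intro x
      rw [show u - u * x = u * (1 - x) by ring, powDensity_mul hu, powDensity_mul hu,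
        ENNReal.ofReal_mul (by positivity)]
      ring
    simp_rw [h]
    rw [lintegral_const_mul' _ _ ENNReal.ofReal_ne_top,
      lintegral_powDensity_mul_powDensity_one_sub ha hb, powDensity_of_nonneg hu.le,
      ← mul_assoc, ← ENNReal.ofReal_mul hu.le, mul_comm]
    apply le_of_eq
    congr 2
    rw [Real.rpow_sub_one hu.ne', Real.rpow_sub_one hu.ne', Real.rpow_sub_one hu.ne',
      Real.rpow_add hu]
    field_simp

lemma lintegral_fin_succ_insertNth {n : ℕ} (i : Fin (n + 1)) {f : (Fin (n + 1) → ℝ) → ENNReal}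
    (hf : Measurable f) :
    ∫⁻ x, f x = ∫⁻ y : Fin n → ℝ, ∫⁻ t : ℝ, f (i.insertNth t y) := by
  have h := (volume_preserving_piFinSuccAbove (fun _ : Fin (n + 1) => ℝ) i).symm
  rw [h.lintegral_map_equiv f, Measure.volume_eq_prod, lintegral_prod_symm]
  · rfl
  · exact (hf.comp (MeasurableEquiv.measurable _)).aemeasurable

lemma lintegral_fin_prod_eq_prod {n : ℕ} (f : Fin n → ℝ → ENNReal) (hf : ∀ i, Measurable (f i)) :
    ∫⁻ x : Fin n → ℝ, ∏ i, f i (x i) = ∏ i, ∫⁻ t, f i t := by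
  induction n with
  | zero => simp [volume_pi]
  | succ n ih =>
    rw [lintegral_fin_succ_insertNth 0 (by fun_prop)]
    simp only [Fin.insertNth_zero', Fin.prod_univ_succ, Fin.cons_zero, Fin.cons_succ]
    have h : ∀ y : Fin n → ℝ, ∫⁻ t : ℝ, f 0 t * ∏ i : Fin n, f i.succ (y i) =
        (∫⁻ t, f 0 t) * ∏ i : Fin n, f i.succ (y i) := fun y => lintegral_mul_const _ (hf 0)
    simp_rw [h]
    rw [lintegral_const_mul _ (by fun_prop), ih _ fun i => hf _]

/-- The Dirichlet integral over the simplex of size `u`. -/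
lemma lintegral_prod_powDensity_le {n : ℕ} (a : Fin n → ℝ) (ha : ∀ i, 0 < a i) {b : ℝ}
    (hb : 0 < b) (u : ℝ) :
    ∫⁻ x : Fin n → ℝ, (∏ i, powDensity (a i) (x i)) * powDensity b (u - ∑ i, x i) ≤
      ENNReal.ofReal ((∏ i, Real.Gamma (a i)) * Real.Gamma b / Real.Gamma (∑ i, a i + b)) *
        powDensity (∑ i, a i + b) u := by
  induction n generalizing b u with
  | zero => simp [volume_pi, (Real.Gamma_pos_of_pos hb).ne']
  | succ n ih =>
    rw [lintegral_fin_succ_insertNth 0 (by fun_prop)]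
    simp only [Fin.insertNth_zero', Fin.prod_univ_succ, Fin.sum_univ_succ, Fin.cons_zero,
      Fin.cons_succ]
    have hs : 0 ≤ ∑ i : Fin n, a i.succ := Finset.sum_nonneg fun i _ => (ha _).le
    -- Integrating out coordinate `0` merges its parameter into the last one, `b` becoming `a 0 +
    -- b`; the beta factors telescope into Gamma functions.
    have h : ∀ y : Fin n → ℝ, ∫⁻ t : ℝ, (powDensity (a 0) t * ∏ i : Fin n, powDensity (a i.succ) (y i)) *
        powDensity b (u - (t + ∑ i, y i)) ≤
        ENNReal.ofReal (ProbabilityTheory.beta (a 0) b) *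
        ((∏ i : Fin n, powDensity (a i.succ) (y i)) * powDensity (a 0 + b) (u - ∑ i, y i)) := by
      intro y
      calc _ = ∫⁻ t : ℝ, (∏ i : Fin n, powDensity (a i.succ) (y i)) *
            (powDensity (a 0) t * powDensity b ((u - ∑ i, y i) - t)) := by
            refine lintegral_congr fun t => ?_
            rw [show u - (t + ∑ i, y i) = (u - ∑ i, y i) - t by ring]; ring
        _ = (∏ i : Fin n, powDensity (a i.succ) (y i)) *
            ∫⁻ t : ℝ, (powDensity (a 0) t * powDensity b ((u - ∑ i, y i) - t)) :=
            lintegral_const_mul _ (by fun_prop)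
        _ ≤ _ := by
            rw [mul_left_comm]
            gcongr
            exact lintegral_powDensity_mul_powDensity_sub_le (ha 0) hb _
    refine (lintegral_mono h).trans ?_
    rw [lintegral_const_mul _ (by fun_prop)]
    have hab : 0 < a 0 + b := add_pos (ha 0) hb
    refine (mul_le_mul_right (ih (fun i => a i.succ) (fun i => ha _) hab u) _).trans ?_
    rw [← mul_assoc, ← ENNReal.ofReal_mul (ProbabilityTheory.beta_pos (ha 0) hb).le,
      show ∑ i : Fin n, a i.succ + (a 0 + b) = a 0 + ∑ i : Fin n, a i.succ + b by ring]
    apply le_of_eq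
    congr 2
    have h1 := (Real.Gamma_pos_of_pos hab).ne'
    have h2 := (Real.Gamma_pos_of_pos (by linarith [ha 0] : 0 < a 0 + ∑ i : Fin n, a i.succ + b)).ne'
    rw [ProbabilityTheory.beta]
    field_simp

/-! ### Mass and symmetry of the Dirichlet measure -/

lemma measurable_simplexParam {n : ℕ} : Measurable (simplexParam (n := n)) := by
  rw [measurable_pi_iff]
  intro i
  refine Fin.lastCases ?_ (fun j => ?_) i
  · simp only [simplexParam, Fin.snoc_last]; fun_prop
  · simp only [simplexParam, Fin.snoc_castSucc]; fun_prop

lemma measurable_dirichletPDF {M : ℕ} (a : Fin M → ℝ) : Measurable (dirichletPDF a) :=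
  Measurable.indicator (by fun_prop) (isClosed_stdSimplex ℝ (Fin M)).measurableSet

lemma sum_simplexParam {n : ℕ} (x : Fin n → ℝ) : ∑ j, simplexParam x j = 1 := by
  simp [simplexParam, Fin.sum_univ_castSucc]

lemma dirichletConst_pos {M : ℕ} {a : Fin (M + 1) → ℝ} (ha : ∀ j, 0 < a j) :
    0 < Real.Gamma (∑ j, a j) / ∏ j, Real.Gamma (a j) :=
  div_pos (Real.Gamma_pos_of_pos (Finset.sum_pos (fun j _ => ha j) Finset.univ_nonempty))
    (Finset.prod_pos fun j _ => Real.Gamma_pos_of_pos (ha j))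

lemma ofReal_dirichletPDF_simplexParam {n : ℕ} {a : Fin (n + 1) → ℝ} (ha : ∀ j, 0 < a j)
    (x : Fin n → ℝ) :
    ENNReal.ofReal (dirichletPDF a (simplexParam x)) =
      ENNReal.ofReal (Real.Gamma (∑ j, a j) / ∏ j, Real.Gamma (a j)) *
        ∏ j, powDensity (a j) (simplexParam x j) := by
  have hc := dirichletConst_pos ha
  by_cases h : simplexParam x ∈ stdSimplex ℝ (Fin (n + 1))
  · rw [dirichletPDF, Set.indicator_of_mem h, ENNReal.ofReal_mul hc.le,
      ENNReal.ofReal_prod_of_nonneg fun j _ => Real.rpow_nonneg (h.1 j) _]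
    congr 1
    exact Finset.prod_congr rfl fun j _ => (powDensity_of_nonneg (h.1 j)).symm
  · rw [dirichletPDF, Set.indicator_of_notMem h]
    have : ∃ j, simplexParam x j < 0 := by
      by_contra! hcon
      exact h ⟨hcon, sum_simplexParam x⟩
    obtain ⟨j, hj⟩ := this
    rw [Finset.prod_eq_zero (f := fun j => powDensity (a j) (simplexParam x j)) (Finset.mem_univ j)
      (powDensity_of_neg hj)]
    simp

lemma dirichletMeasure_apply {n : ℕ} (a : Fin (n + 1) → ℝ) {s : Set (Fin (n + 1) → ℝ)}
    (hs : MeasurableSet s) :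
    dirichletMeasure a s = ∫⁻ x : Fin n → ℝ,
      (simplexParam ⁻¹' s).indicator (fun x => ENNReal.ofReal (dirichletPDF a (simplexParam x))) x := by
  rw [dirichletMeasure, Measure.map_apply measurable_simplexParam hs,
    withDensity_apply _ (measurable_simplexParam hs),
    lintegral_indicator (measurable_simplexParam hs)]

lemma dirichletMeasure_univ_le_one {M : ℕ} {a : Fin M → ℝ} (ha : ∀ j, 0 < a j) :
    dirichletMeasure a Set.univ ≤ 1 := by
  cases M with
  | zero => simp [dirichletMeasure]
  | succ n =>
    rw [dirichletMeasure_apply a MeasurableSet.univ]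
    simp only [Set.preimage_univ, Set.indicator_univ, ofReal_dirichletPDF_simplexParam ha]
    have hc := dirichletConst_pos ha
    rw [lintegral_const_mul' _ _ ENNReal.ofReal_ne_top]
    have h := lintegral_prod_powDensity_le (fun i : Fin n => a i.castSucc) (fun i => ha _)
      (ha (Fin.last n)) 1
    simp only [Fin.prod_univ_castSucc, simplexParam, Fin.snoc_castSucc, Fin.snoc_last]
    refine (mul_le_mul_right h _).trans ?_
    rw [powDensity_of_nonneg zero_le_one, ← mul_assoc, ← ENNReal.ofReal_mul (by
      simpa [Fin.prod_univ_castSucc] using hc.le), ← Fin.prod_univ_castSucc (fun j => Real.Gamma (a j)),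
      ← Fin.sum_univ_castSucc a]
    have h1 := (Real.Gamma_pos_of_pos (Finset.sum_pos (fun j _ => ha j) Finset.univ_nonempty)).ne'
    have h2 := (Finset.prod_pos fun j (_ : j ∈ Finset.univ) => Real.Gamma_pos_of_pos (ha j)).ne'
    simp
    field_simp
    simp

lemma simplexParam_comp_swap_last {n : ℕ} (i : Fin n) (x : Fin n → ℝ) :
    simplexParam x ∘ Equiv.swap i.castSucc (Fin.last n) =
      simplexParam (Function.update x i (1 - ∑ j, x j)) := by
  funext k
  refine Fin.lastCases ?_ (fun j => ?_) k
  · simp [simplexParam, Finset.sum_update_of_mem]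
  · by_cases hj : j = i
    · subst hj; simp [simplexParam]
    · have h1 : j.castSucc ≠ i.castSucc := by simpa using hj
      simp [simplexParam, Equiv.swap_apply_of_ne_of_ne h1 (Fin.castSucc_ne_last j), hj]

/-- With the other coordinates fixed, the map is a reflection `t ↦ const - t` of coordinate `i`,
hence preserves Lebesgue measure. It is the exchange of coordinate `i` with the last, read in the
chart. -/
lemma lintegral_update_one_sub_sum {n : ℕ} (i : Fin n) {f : (Fin n → ℝ) → ENNReal}
    (hf : Measurable f) :
    ∫⁻ x, f (Function.update x i (1 - ∑ j, x j)) = ∫⁻ x, f x := by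
  cases n with
  | zero => exact i.elim0
  | succ n =>
    have hm : Measurable fun x : Fin (n + 1) → ℝ => Function.update x i (1 - ∑ j, x j) := by
      rw [measurable_pi_iff]
      intro j
      by_cases h : j = i
      · subst h; simp; fun_prop
      · simp [h]; fun_prop
    rw [lintegral_fin_succ_insertNth (f := fun x => f (Function.update x i (1 - ∑ j, x j))) i
      (hf.comp hm), lintegral_fin_succ_insertNth i hf]
    refine lintegral_congr fun y => ?_
    have : ∀ t : ℝ, Function.update (i.insertNth t y : Fin (n + 1) → ℝ) i
        (1 - ∑ j, (i.insertNth t y : Fin (n + 1) → ℝ) j) = i.insertNth ((1 - ∑ j, y j) - t) y := by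
      intro t
      rw [Fin.update_insertNth, Fin.sum_univ_succAbove _ i]
      simp only [Fin.insertNth_apply_same, Fin.insertNth_apply_succAbove]
      rw [show 1 - (t + ∑ j, y j) = 1 - ∑ j, y j - t by ring]
    simp only [this]
    exact lintegral_sub_left_eq_self (fun t => f (i.insertNth t y)) _

lemma dirichletPDF_const_comp_perm {M : ℕ} (ρ : ℝ) (σ : Equiv.Perm (Fin M)) (l : Fin M → ℝ) :
    dirichletPDF (fun _ => ρ) (l ∘ σ) = dirichletPDF (fun _ => ρ) l := by
  have h : l ∘ σ ∈ stdSimplex ℝ (Fin M) ↔ l ∈ stdSimplex ℝ (Fin M) := by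
    simp only [stdSimplex, Set.mem_ofPred_eq, Function.comp_apply]
    rw [σ.forall_congr_left, Equiv.sum_comp σ l]
    simp
  by_cases hl : l ∈ stdSimplex ℝ (Fin M)
  · rw [dirichletPDF, Set.indicator_of_mem hl, Set.indicator_of_mem (h.2 hl)]
    congr 1
    exact Equiv.prod_comp σ fun j => l j ^ (ρ - 1)
  · rw [dirichletPDF, Set.indicator_of_notMem hl, Set.indicator_of_notMem (mt h.1 hl)]

/-- The symmetric Dirichlet distribution is invariant under exchanging a coordinate with the last. -/
lemma symmDirichlet_preimage_swap_last {n : ℕ} (ρ : ℝ) (k : Fin (n + 1))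
    {s : Set (Fin (n + 1) → ℝ)} (hs : MeasurableSet s) :
    symmDirichlet (n + 1) ρ ((fun l => l ∘ Equiv.swap k (Fin.last n)) ⁻¹' s) =
      symmDirichlet (n + 1) ρ s := by
  refine Fin.lastCases ?_ (fun i => ?_) k
  · simp
  have hm : Measurable fun l : Fin (n + 1) → ℝ => l ∘ Equiv.swap i.castSucc (Fin.last n) :=
    measurable_pi_iff.2 fun j => measurable_pi_apply _
  rw [symmDirichlet, dirichletMeasure_apply _ hs, dirichletMeasure_apply _ (hm hs),
    ← lintegral_update_one_sub_sum i (f := (simplexParam ⁻¹' s).indicator _)]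
  · refine lintegral_congr fun x => ?_
    have h := simplexParam_comp_swap_last i x
    have h' := dirichletPDF_const_comp_perm ρ (Equiv.swap i.castSucc (Fin.last n)) (simplexParam x)
    rw [h] at h'
    have hmem : x ∈ simplexParam ⁻¹' ((fun l => l ∘ Equiv.swap i.castSucc (Fin.last n)) ⁻¹' s) ↔
        Function.update x i (1 - ∑ j, x j) ∈ simplexParam ⁻¹' s := by
      rw [Set.mem_preimage, Set.mem_preimage, Set.mem_preimage, h]
    by_cases hx : Function.update x i (1 - ∑ j, x j) ∈ simplexParam ⁻¹' s
    · rw [Set.indicator_of_mem hx, Set.indicator_of_mem (hmem.2 hx), h']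
    · rw [Set.indicator_of_notMem hx, Set.indicator_of_notMem (mt hmem.1 hx)]
  · exact ((measurable_dirichletPDF _).comp measurable_simplexParam).ennreal_ofReal.indicator
      (measurable_simplexParam hs)

/-! ### Tilting, Markov's inequality and the union bound -/

/-- On this event `1 ≤ t ^ (-(b * S.card)) * ∏ j ∈ S, l j ^ b`, and the factor `l j ^ b` raises the
`j`-th parameter by `b`. The quotient corrects the normalizing constants. -/
lemma dirichletPDF_le_of_forall_lt {n : ℕ} {a : Fin (n + 1) → ℝ} (ha : ∀ j, 0 < a j)
    (S : Finset (Fin (n + 1))) {b t : ℝ} (hb : 0 < b) (ht : 0 < t) {l : Fin (n + 1) → ℝ}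
    (hl : ∀ j ∈ S, t < l j) :
    dirichletPDF a l ≤ t ^ (-(b * S.card)) *
      ((Real.Gamma (∑ j, a j) / ∏ j, Real.Gamma (a j)) /
        (Real.Gamma (∑ j, (a j + if j ∈ S then b else 0)) /
          ∏ j, Real.Gamma (a j + if j ∈ S then b else 0))) *
      dirichletPDF (fun j => a j + if j ∈ S then b else 0) l := by
  by_cases h : l ∈ stdSimplex ℝ (Fin (n + 1))
  swap
  · rw [dirichletPDF, dirichletPDF, Set.indicator_of_notMem h, Set.indicator_of_notMem h, mul_zero]
  rw [dirichletPDF, dirichletPDF, Set.indicator_of_mem h, Set.indicator_of_mem h]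
  have hc := dirichletConst_pos ha
  have hc' := dirichletConst_pos (a := fun j => a j + if j ∈ S then b else 0) fun j => by
    have := ha j
    split_ifs <;> positivity
  set c := Real.Gamma (∑ j, a j) / ∏ j, Real.Gamma (a j)
  set c' := Real.Gamma (∑ j, (a j + if j ∈ S then b else 0)) /
          ∏ j, Real.Gamma (a j + if j ∈ S then b else 0)
  have h1 : ∏ j, l j ^ (a j + (if j ∈ S then b else 0) - 1) =
      (∏ j, l j ^ (a j - 1)) * ∏ j ∈ S, l j ^ b := by
    have : ∏ j ∈ S, l j ^ b = ∏ j, if j ∈ S then l j ^ b else 1 := by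
      rw [Finset.prod_ite_mem, Finset.univ_inter]
    rw [this, ← Finset.prod_mul_distrib]
    refine Finset.prod_congr rfl fun j _ => ?_
    split_ifs with hj
    · rw [← Real.rpow_add (ht.trans (hl j hj))]; ring_nf
    · simp
  have h2 : t ^ (b * S.card) ≤ ∏ j ∈ S, l j ^ b := by
    rw [Real.rpow_mul ht.le, Real.rpow_natCast, ← Finset.prod_const]
    exact Finset.prod_le_prod (fun _ _ => by positivity) fun j hj =>
      Real.rpow_le_rpow ht.le (hl j hj).le hb.le
  have h3 : 0 ≤ ∏ j, l j ^ (a j - 1) := Finset.prod_nonneg fun j _ => Real.rpow_nonneg (h.1 j) _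
  rw [h1, Real.rpow_neg ht.le]
  have h4 : 0 < t ^ (b * S.card) := by positivity
  calc c * ∏ j, l j ^ (a j - 1)
      = (t ^ (b * S.card))⁻¹ * (c / c') * (c' * ((∏ j, l j ^ (a j - 1)) * t ^ (b * S.card))) := by
        field_simp
    _ ≤ _ := by gcongr

/-- Markov's inequality for the product of the `b`-th powers of the coordinates in `S`. -/
lemma dirichletMeasure_forall_lt_le {n : ℕ} {a : Fin (n + 1) → ℝ} (ha : ∀ j, 0 < a j)
    (S : Finset (Fin (n + 1))) {b t : ℝ} (hb : 0 < b) (ht : 0 < t) :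
    dirichletMeasure a {l | ∀ j ∈ S, t < l j} ≤ ENNReal.ofReal (t ^ (-(b * S.card)) *
      ((Real.Gamma (∑ j, a j) / ∏ j, Real.Gamma (a j)) /
        (Real.Gamma (∑ j, (a j + if j ∈ S then b else 0)) /
          ∏ j, Real.Gamma (a j + if j ∈ S then b else 0)))) := by
  have hpos : ∀ j, 0 < a j + if j ∈ S then b else 0 := fun j => by
    have := ha j
    split_ifs <;> positivity
  have hc := dirichletConst_pos ha
  have hc' := dirichletConst_pos hpos
  have hm : MeasurableSet {l : Fin (n + 1) → ℝ | ∀ j ∈ S, t < l j} := by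
    have : {l : Fin (n + 1) → ℝ | ∀ j ∈ S, t < l j} = ⋂ j ∈ S, {l | t < l j} := by ext; simp
    rw [this]
    exact Finset.measurableSet_biInter _ fun j _ =>
      measurableSet_lt measurable_const (measurable_pi_apply j)
  have hR := mul_nonneg (Real.rpow_nonneg ht.le (-(b * S.card))) (div_nonneg hc.le hc'.le)
  rw [dirichletMeasure_apply a hm]
  refine le_trans (lintegral_mono (g := fun x => ENNReal.ofReal (t ^ (-(b * S.card)) *
      ((Real.Gamma (∑ j, a j) / ∏ j, Real.Gamma (a j)) /
        (Real.Gamma (∑ j, (a j + if j ∈ S then b else 0)) /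
          ∏ j, Real.Gamma (a j + if j ∈ S then b else 0)))) *
      ENNReal.ofReal (dirichletPDF (fun j => a j + if j ∈ S then b else 0) (simplexParam x)))
      fun x => ?_) ?_
  · by_cases hx : x ∈ simplexParam ⁻¹' {l : Fin (n + 1) → ℝ | ∀ j ∈ S, t < l j}
    swap
    · rw [Set.indicator_of_notMem hx]; exact zero_le
    rw [Set.indicator_of_mem hx]
    beta_reduce
    rw [← ENNReal.ofReal_mul hR]
    exact ENNReal.ofReal_le_ofReal (dirichletPDF_le_of_forall_lt ha S hb ht hx)
  · rw [lintegral_const_mul' _ _ ENNReal.ofReal_ne_top]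
    have h := dirichletMeasure_univ_le_one hpos
    rw [dirichletMeasure_apply _ MeasurableSet.univ] at h
    simp only [Set.preimage_univ, Set.indicator_univ] at h
    exact (mul_le_mul_right h _).trans_eq (mul_one _)

lemma symmDirichlet_forall_lt_le {n : ℕ} {ρ : ℝ} (hρ : 0 < ρ)
    (S : Finset (Fin (n + 1))) {b t : ℝ} (hb : 0 < b) (ht : 0 < t) :
    symmDirichlet (n + 1) ρ {l | ∀ j ∈ S, t < l j} ≤ ENNReal.ofReal (t ^ (-(b * S.card)) *
      (Real.Gamma (ρ + b) / Real.Gamma ρ) ^ S.card *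
        (Real.Gamma ((n + 1 : ℕ) * ρ) / Real.Gamma ((n + 1 : ℕ) * ρ + S.card * b))) := by
  refine (dirichletMeasure_forall_lt_le (fun _ => hρ) S hb ht).trans_eq ?_
  have h1 : ∑ j, (ρ + if j ∈ S then b else 0) = (n + 1 : ℕ) * ρ + S.card * b := by
    rw [Finset.sum_add_distrib]
    simp
  have h2 : ∏ j, Real.Gamma (ρ + if j ∈ S then b else 0) =
      (∏ _j : Fin (n + 1), Real.Gamma ρ) * (Real.Gamma (ρ + b) / Real.Gamma ρ) ^ S.card := by
    have h3 : ∏ j, (if j ∈ S then Real.Gamma (ρ + b) / Real.Gamma ρ else 1) =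
        (Real.Gamma (ρ + b) / Real.Gamma ρ) ^ S.card := by
      rw [Finset.prod_ite_mem, Finset.univ_inter, Finset.prod_const]
    rw [← h3, ← Finset.prod_mul_distrib]
    refine Finset.prod_congr rfl fun j _ => ?_
    have := (Real.Gamma_pos_of_pos hρ).ne'
    split_ifs
    · field_simp
    · simp
  have h4 : 0 < ∏ _j : Fin (n + 1), Real.Gamma ρ :=
    Finset.prod_pos fun _ _ => Real.Gamma_pos_of_pos hρ
  rw [h1, h2]
  congr 1
  rw [mul_assoc]
  congr 1
  have h5 : ∑ _j : Fin (n + 1), ρ = (n + 1 : ℕ) * ρ := by simp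
  rw [h5]
  have h6 := Real.Gamma_pos_of_pos (by positivity : 0 < (n + 1 : ℕ) * ρ + S.card * b)
  have h7 := Real.Gamma_pos_of_pos (by positivity : 0 < ρ + b)
  have h8 := Real.Gamma_pos_of_pos hρ
  field_simp

/-- The tail has at most `M` terms and sum above `ε`, so one of them exceeds `ε / M`; so do the `s +
1` largest coordinates. -/
lemma exists_powersetCard_forall_lt {M s : ℕ} (hs : s < M) {ε : ℝ} (hε : 0 ≤ ε) {l : Fin M → ℝ}
    (hl : l ∈ stdSimplex ℝ (Fin M)) (h : l ∉ approxSparse M s ε) :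
    ∃ S ∈ Finset.powersetCard (s + 1) (Finset.univ : Finset (Fin M)), ∀ j ∈ S, ε / M < l j := by
  have hM : (0 : ℝ) < M := by exact_mod_cast (by omega : 0 < M)
  have hsum : ε < ∑ j ∈ Finset.univ.filter (fun j : Fin M => s ≤ (j : ℕ)), orderedDesc l j := by
    by_contra! hcon
    exact h ⟨hl, hcon⟩
  obtain ⟨k, hk, hlt⟩ : ∃ k : Fin M, s ≤ (k : ℕ) ∧ ε / M < orderedDesc l k := by
    by_contra! hcon
    refine absurd hsum (not_lt.2 ?_)
    calc _ ≤ ∑ j ∈ Finset.univ.filter (fun j : Fin M => s ≤ (j : ℕ)), ε / M :=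
          Finset.sum_le_sum fun j hj => hcon j (Finset.mem_filter.1 hj).2
      _ ≤ ∑ j : Fin M, ε / M :=
          Finset.sum_le_sum_of_subset_of_nonneg (Finset.filter_subset _ _)
            fun _ _ _ => by positivity
      _ = ε := by simp; field_simp
  refine ⟨(Finset.univ : Finset (Fin (s + 1))).map
    ⟨fun i => Tuple.sort l (Fin.rev (Fin.castLE hs i)), ?_⟩, ?_, ?_⟩
  · exact (Tuple.sort l).injective.comp (Fin.rev_injective.comp (Fin.castLE_injective hs))
  · simp [Finset.mem_powersetCard]
  · intro j hj
    obtain ⟨i, -, rfl⟩ := Finset.mem_map.1 hj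
    refine hlt.trans_le (Tuple.monotone_sort l ?_)
    rw [Fin.rev_le_rev, Fin.le_def]
    simp
    omega

lemma stdSimplex_subset_approxSparse {M s : ℕ} (hs : M ≤ s) {ε : ℝ} (hε : 0 ≤ ε) :
    stdSimplex ℝ (Fin M) ⊆ approxSparse M s ε := fun l hl => by
  refine ⟨hl, ?_⟩
  rw [Finset.filter_false_of_mem fun j _ => by omega]
  simpa

lemma dirichletMeasure_compl_stdSimplex {M : ℕ} (a : Fin M → ℝ) :
    dirichletMeasure a (stdSimplex ℝ (Fin M))ᶜ = 0 := by
  cases M with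
  | zero => simp [dirichletMeasure]
  | succ n =>
    rw [dirichletMeasure_apply a (isClosed_stdSimplex ℝ (Fin (n + 1))).measurableSet.compl,
      lintegral_eq_zero_of_ae_eq_zero]
    refine Filter.Eventually.of_forall fun x => ?_
    by_cases h : simplexParam x ∈ stdSimplex ℝ (Fin (n + 1))
    · exact Set.indicator_of_notMem (by simpa using h) _
    · simp [Set.indicator, dirichletPDF, h]

lemma symmDirichlet_real_not_mem_approxSparse_le {M s : ℕ} (hs : s < M) {ρ b ε : ℝ} (hρ : 0 < ρ)
    (hb : 0 < b) (hε : 0 < ε) :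
    (symmDirichlet M ρ).real {l | l ∉ approxSparse M s ε} ≤
      (M : ℝ) ^ (s + 1) * ((ε / M) ^ (-(b * (s + 1 : ℕ))) *
      (Real.Gamma (ρ + b) / Real.Gamma ρ) ^ (s + 1) *
        (Real.Gamma (M * ρ) / Real.Gamma (M * ρ + (s + 1 : ℕ) * b))) := by
  obtain ⟨n, rfl⟩ := Nat.exists_eq_succ_of_ne_zero (by omega : M ≠ 0)
  have hM : (0 : ℝ) < (n + 1 : ℕ) := by positivity
  have ht : 0 < ε / (n + 1 : ℕ) := by positivity
  set B := (ε / (n + 1 : ℕ)) ^ (-(b * (s + 1 : ℕ))) *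
      (Real.Gamma (ρ + b) / Real.Gamma ρ) ^ (s + 1) *
        (Real.Gamma ((n + 1 : ℕ) * ρ) / Real.Gamma ((n + 1 : ℕ) * ρ + (s + 1 : ℕ) * b)) with hB
  have hB0 : 0 ≤ B := by
    have h1 := Real.Gamma_pos_of_pos hρ
    have h2 := Real.Gamma_pos_of_pos (by positivity : 0 < ρ + b)
    have h3 := Real.Gamma_pos_of_pos (by positivity : 0 < (n + 1 : ℕ) * ρ)
    have h4 := Real.Gamma_pos_of_pos (by positivity : 0 < (n + 1 : ℕ) * ρ + (s + 1 : ℕ) * b)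
    positivity
  rw [measureReal_def]
  refine ENNReal.toReal_le_of_le_ofReal (by positivity) ?_
  have hsub : {l | l ∉ approxSparse (n + 1) s ε} ⊆ (stdSimplex ℝ (Fin (n + 1)))ᶜ ∪
      ⋃ S ∈ Finset.powersetCard (s + 1) (Finset.univ : Finset (Fin (n + 1))),
        {l | ∀ j ∈ S, ε / (n + 1 : ℕ) < l j} := by
    intro l hl
    by_cases h : l ∈ stdSimplex ℝ (Fin (n + 1))
    · right
      obtain ⟨S, hS, hS'⟩ := exists_powersetCard_forall_lt hs hε.le h hl
      exact Set.mem_biUnion hS hS'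
    · exact Or.inl h
  calc _ ≤ _ := measure_mono hsub
    _ ≤ _ := measure_union_le _ _
    _ ≤ 0 + ∑ S ∈ Finset.powersetCard (s + 1) (Finset.univ : Finset (Fin (n + 1))),
        symmDirichlet (n + 1) ρ {l | ∀ j ∈ S, ε / (n + 1 : ℕ) < l j} := by
        exact add_le_add (dirichletMeasure_compl_stdSimplex _).le (measure_biUnion_finset_le _ _)
    _ ≤ ∑ S ∈ Finset.powersetCard (s + 1) (Finset.univ : Finset (Fin (n + 1))),
        ENNReal.ofReal B := by
        rw [zero_add]
        refine Finset.sum_le_sum fun S hS => ?_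
        have hc := (Finset.mem_powersetCard.1 hS).2
        have := symmDirichlet_forall_lt_le hρ S hb ht
        rwa [hc] at this
    _ ≤ ENNReal.ofReal (((n + 1 : ℕ) : ℝ) ^ (s + 1) * B) := by
        rw [Finset.sum_const, Finset.card_powersetCard, Finset.card_univ, Fintype.card_fin,
          nsmul_eq_mul, ENNReal.ofReal_mul (p := ((n + 1 : ℕ) : ℝ) ^ (s + 1)) (by positivity)]
        refine mul_le_mul' ?_ le_rfl
        rw [← Nat.cast_pow, ENNReal.ofReal_natCast]
        exact_mod_cast Nat.choose_le_pow (n + 1) (s + 1)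

/-! ### Choice of constants in the sparsity bound -/

lemma exists_pos_forall_le_Gamma : ∃ g : ℝ, 0 < g ∧ ∀ x : ℝ, 0 < x → g ≤ Real.Gamma x := by
  obtain ⟨x, hx, hmin⟩ := Real.exists_isMinOn_Gamma_Ioi
  exact ⟨Real.Gamma x, Real.Gamma_pos_of_pos (by linarith [hx.1]), fun y hy => hmin hy⟩

lemma Gamma_le_max_of_mem_Icc {p q x : ℝ} (hp : 0 < p) (hx : x ∈ Set.Icc p q) :
    Real.Gamma x ≤ max (Real.Gamma p) (Real.Gamma q) :=
  Real.convexOn_Gamma.le_max_of_mem_Icc hp (hp.trans_le (hx.1.trans hx.2)) hx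

lemma div_rpow_pos_and_le {α γ : ℝ} (hα : 0 < α) (hγ : 1 < γ) {M : ℕ} (hM : 1 ≤ M) :
    0 < α / (M : ℝ) ^ γ ∧ α / (M : ℝ) ^ γ ≤ α ∧ M * (α / (M : ℝ) ^ γ) ≤ α := by
  have hM0 : (0 : ℝ) < M := by exact_mod_cast hM
  have hM1 : (1 : ℝ) ≤ M := by exact_mod_cast hM
  have h1 : (M : ℝ) ≤ (M : ℝ) ^ γ := by
    simpa using Real.rpow_le_rpow_of_exponent_le hM1 hγ.le
  have h2 : 0 < (M : ℝ) ^ γ := by positivity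
  have h3 : M * (α / (M : ℝ) ^ γ) ≤ α := by
    rw [← mul_div_assoc, div_le_iff₀ h2, mul_comm]
    gcongr
  have h4 : 0 < α / (M : ℝ) ^ γ := by positivity
  exact ⟨h4, by nlinarith, h3⟩

lemma log_div_le_mul_log {ε₀ κ ε : ℝ} (hε₀ : 0 < ε₀) (hε₀1 : ε₀ < 1) {M : ℕ} (hM : 2 ≤ M)
    (h : ε₀ * (M : ℝ) ^ (-κ) ≤ ε) :
    Real.log (M / ε) ≤ (1 + κ + Real.log (1 / ε₀) / Real.log 2) * Real.log M := by
  have hM2 : (2 : ℝ) ≤ M := by exact_mod_cast hM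
  have hM0 : (0 : ℝ) < M := by linarith
  have hl2 : 0 < Real.log 2 := Real.log_pos (by norm_num)
  have hlog : Real.log 2 ≤ Real.log M := Real.log_le_log (by norm_num) hM2
  have hl0 : 0 ≤ Real.log (1 / ε₀) := Real.log_nonneg (by rw [le_div_iff₀ hε₀]; linarith)
  have hpos : 0 < ε₀ * (M : ℝ) ^ (-κ) := by positivity
  have h1 : Real.log ε₀ - κ * Real.log M ≤ Real.log ε := by
    have := Real.log_le_log hpos h
    rw [Real.log_mul hε₀.ne' (by positivity), Real.log_rpow hM0] at this
    linarith
  rw [Real.log_div hM0.ne' (hpos.trans_le h).ne']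
  have h2 : Real.log (1 / ε₀) ≤ Real.log (1 / ε₀) / Real.log 2 * Real.log M := by
    rw [div_mul_eq_mul_div, le_div_iff₀ hl2]
    gcongr
  have h3 : Real.log (1 / ε₀) = - Real.log ε₀ := by simp
  rw [h3] at h2 ⊢
  linarith

/-- Absorbs a constant to the power `s` into one independent of `s`: either `D ≤ X ^ δ` and the base
is at most `1`, or `X < D ^ (1 / δ)`, which bounds `s ≤ X`. -/
lemma pow_mul_rpow_neg_le {D X δ : ℝ} (hD : 1 ≤ D) (hδ : 0 < δ) {s : ℕ} (hs : (s : ℝ) ≤ X)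
    (hX : 0 < X) : (D * X ^ (-δ)) ^ s ≤ D ^ (D ^ (1 / δ)) := by
  have h1 : 1 ≤ D ^ (D ^ (1 / δ)) := Real.one_le_rpow hD (by positivity)
  rcases le_or_gt D (X ^ δ) with h | h
  · refine le_trans (pow_le_one₀ (by positivity) ?_) h1
    rw [Real.rpow_neg hX.le, ← div_eq_mul_inv]
    exact div_le_one_of_le₀ h (by positivity)
  · rcases le_or_gt X 1 with hX1 | hX1
    · have hs1 : (s : ℝ) ≤ 1 := hs.trans hX1
      rcases Nat.lt_or_ge s 1 with h0 | h0
      · obtain rfl : s = 0 := by omega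
        simpa using h1
      · have : X = 1 := le_antisymm hX1 (le_trans (by exact_mod_cast h0) hs)
        obtain rfl : s = 1 := le_antisymm (by exact_mod_cast hs1) h0
        subst this
        simp only [Real.one_rpow, mul_one, pow_one]
        calc D = D ^ (1 : ℝ) := by simp
          _ ≤ _ := Real.rpow_le_rpow_of_exponent_le hD (Real.one_le_rpow hD (by positivity))
    · have hXD : X ≤ D ^ (1 / δ) := by
        rw [one_div, Real.le_rpow_inv_iff_of_pos hX.le (by linarith) hδ]
        exact h.le
      calc (D * X ^ (-δ)) ^ s ≤ D ^ s := by
            refine pow_le_pow_left₀ (by positivity) ?_ s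
            exact mul_le_of_le_one_right (by linarith)
              (Real.rpow_le_one_of_one_le_of_nonpos hX1.le (by linarith))
        _ = D ^ (s : ℝ) := (Real.rpow_natCast _ _).symm
        _ ≤ _ := Real.rpow_le_rpow_of_exponent_le hD (hs.trans hXD)

/-- Bound for the union of the events that `s + 1` given coordinates are all large. -/
lemma symmDirichlet_real_not_mem_approxSparse_le_pow {M s : ℕ} (hs1 : 1 ≤ s) (hs : s < M)
    {ρ b ε g G B : ℝ} (hρ : 0 < ρ) (hb : 0 < b) (hε : 0 < ε) (hε1 : ε < 1) (hg : 0 < g)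
    (hΓ : ∀ x : ℝ, 0 < x → g ≤ Real.Gamma x) (hG : Real.Gamma (M * ρ + 1) ≤ G)
    (hB : Real.Gamma (ρ + b) ≤ B * g) (hB1 : 1 ≤ B) :
    (symmDirichlet M ρ).real {l | l ∉ approxSparse M s ε} ≤
      G / g * (M * ρ * (B * (M / ε) ^ b) ^ 2) ^ s := by
  have hM0 : (0 : ℝ) < M := by exact_mod_cast (by omega : 0 < M)
  have hM1 : (1 : ℝ) ≤ M := by exact_mod_cast (by omega : 1 ≤ M)
  have hX : 1 ≤ M / ε := by rw [le_div_iff₀ hε]; linarith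
  have hX0 : 0 < M / ε := by positivity
  have hMρ : 0 < M * ρ := by positivity
  have hG0 : 0 < G := (Real.Gamma_pos_of_pos (by positivity)).trans_le hG
  refine (symmDirichlet_real_not_mem_approxSparse_le hs hρ hb hε).trans ?_
  have h1 : (ε / M) ^ (-(b * (s + 1 : ℕ))) = ((M / ε) ^ b) ^ (s + 1) := by
    rw [Real.rpow_neg (by positivity), ← Real.inv_rpow (by positivity), inv_div,
      Real.rpow_mul hX0.le, Real.rpow_natCast]
  have h2 : Real.Gamma (ρ + b) / Real.Gamma ρ ≤ ρ * B := by
    have h3 := hΓ (ρ + 1) (by positivity)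
    rw [Real.Gamma_add_one hρ.ne'] at h3
    rw [div_le_iff₀ (Real.Gamma_pos_of_pos hρ)]
    calc _ ≤ B * g := hB
      _ ≤ B * (ρ * Real.Gamma ρ) := by gcongr
      _ = _ := by ring
  have h20 : 0 ≤ Real.Gamma (ρ + b) / Real.Gamma ρ :=
    div_nonneg (Real.Gamma_pos_of_pos (by positivity)).le (Real.Gamma_pos_of_pos hρ).le
  -- The pole of `Γ` at `0` costs one factor `1 / (M * ρ)`; this turns `(M * ρ) ^ (s + 1)` into `(M
  -- * ρ) ^ s`.
  have h4 : Real.Gamma (M * ρ) / Real.Gamma (M * ρ + (s + 1 : ℕ) * b) ≤ G / (M * ρ) / g := by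
    rw [Real.Gamma_add_one hMρ.ne'] at hG
    have := hΓ (M * ρ + (s + 1 : ℕ) * b) (by positivity)
    gcongr
    rw [le_div_iff₀ hMρ]
    linarith
  have h40 : 0 ≤ Real.Gamma (M * ρ) / Real.Gamma (M * ρ + (s + 1 : ℕ) * b) :=
    div_nonneg (Real.Gamma_pos_of_pos hMρ).le (Real.Gamma_pos_of_pos (by positivity)).le
  have hY : 1 ≤ B * (M / ε) ^ b :=
    one_le_mul_of_one_le_of_one_le hB1 (Real.one_le_rpow hX hb.le)
  rw [h1]
  calc _ ≤ (M : ℝ) ^ (s + 1) * (((M / ε) ^ b) ^ (s + 1) * (ρ * B) ^ (s + 1) *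
        (G / (M * ρ) / g)) := by gcongr
    _ = G / g * ((M * ρ) ^ s * (B * (M / ε) ^ b) ^ (s + 1)) := by
      field_simp
      ring
    -- `s + 1 ≤ 2 * s` makes the whole bound an `s`-th power.
    _ ≤ G / g * ((M * ρ) ^ s * (B * (M / ε) ^ b) ^ (2 * s)) := by
      gcongr
      · omega
    _ = _ := by rw [mul_pow (M * ρ), ← pow_mul]

theorem symmDirichlet_not_mem_approxSparse_le {ε₀ : ℝ} (hε₀ : 0 < ε₀) (hε₀1 : ε₀ < 1) {κ : ℝ}
    (hκ : 0 ≤ κ) : ∃ C : ℝ, 0 < C ∧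
      ∀ α : ℝ, 0 < α → ∀ γ : ℝ, 1 < γ → ∃ K : ℝ, 0 < K ∧
        ∀ M s : ℕ, 1 ≤ s → s ≤ M →
        ∀ ε : ℝ, ε₀ * (M : ℝ) ^ (-κ) ≤ ε → ε < 1 →
          (symmDirichlet M (α / (M : ℝ) ^ γ)).real {l | l ∉ approxSparse M s ε} ≤
            K * Real.exp (-(C * (γ - 1) * s * Real.log (M / ε))) := by
  have hl2 : 0 < Real.log 2 := Real.log_pos (by norm_num)
  have hl0 : 0 ≤ Real.log (1 / ε₀) := Real.log_nonneg (by rw [le_div_iff₀ hε₀]; linarith)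
  set C' := 1 + κ + Real.log (1 / ε₀) / Real.log 2 with hC'
  have hC'0 : 0 < C' := by positivity
  obtain ⟨g, hg, hΓ⟩ := exists_pos_forall_le_Gamma
  refine ⟨1 / (4 * C'), by positivity, fun α hα γ hγ => ?_⟩
  -- Also the Markov exponent `b`. With `X = M / ε`, `M * ρ ≤ α * X ^ (-4δ)` and Markov costs `X ^
  -- (2δ)` per factor. Of the remaining `X ^ (-2δ)`, one half absorbs `D`, the other is the claimed
  -- decay.
  set δ := 1 / (4 * C') * (γ - 1) with hδ
  have hδ0 : 0 < δ := mul_pos (by positivity) (by linarith)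
  set B := max 1 (max (Real.Gamma δ) (Real.Gamma (α + δ)) / g) with hB
  set G := max (Real.Gamma 1) (Real.Gamma (α + 1)) with hG
  set D := max 1 (α * B ^ 2) with hD
  have hB1 : 1 ≤ B := le_max_left _ _
  have hD1 : 1 ≤ D := le_max_left _ _
  have hG0 : 0 < G := lt_max_of_lt_left (by simp)
  refine ⟨G / g * D ^ (D ^ (1 / δ)), by positivity, fun M s hs1 hsM ε hε hε1 => ?_⟩
  have hM0 : (0 : ℝ) < M := by exact_mod_cast (by omega : 0 < M)
  have hε0 : 0 < ε := lt_of_lt_of_le (by positivity) hε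
  have hX : M ≤ M / ε := by rw [le_div_iff₀ hε0]; nlinarith
  have hX0 : 0 < M / ε := by positivity
  rcases hsM.lt_or_eq with hlt | rfl
  swap
  · have : (symmDirichlet s (α / (s : ℝ) ^ γ)).real {l | l ∉ approxSparse s s ε} = 0 := by
      have hsub : {l | l ∉ approxSparse s s ε} ⊆ (stdSimplex ℝ (Fin s))ᶜ :=
        fun l hl hl' => hl (stdSimplex_subset_approxSparse le_rfl hε0.le hl')
      rw [measureReal_def, symmDirichlet, measure_mono_null hsub
        (dirichletMeasure_compl_stdSimplex _), ENNReal.toReal_zero]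
    rw [this]
    positivity
  obtain ⟨hρ, hρα, hMρ⟩ := div_rpow_pos_and_le hα hγ (by omega : 1 ≤ M)
  have h1 := symmDirichlet_real_not_mem_approxSparse_le_pow hs1 hlt hρ hδ0 hε0 hε1 hg hΓ
    (G := G) (B := B)
    (Gamma_le_max_of_mem_Icc one_pos ⟨by linarith [mul_pos hM0 hρ], by linarith⟩)
    (by
      refine (Gamma_le_max_of_mem_Icc hδ0 (q := α + δ) ⟨by linarith, by linarith⟩).trans ?_
      rw [← div_le_iff₀ hg]
      exact le_max_right _ _) hB1
  refine h1.trans ?_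
  have h2 : M * (α / (M : ℝ) ^ γ) ≤ α * (M / ε) ^ (-(4 * δ)) := by
    have h3 := log_div_le_mul_log hε₀ hε₀1 (by omega : 2 ≤ M) hε
    rw [← hC'] at h3
    have h4 : M * (α / (M : ℝ) ^ γ) = α * (M : ℝ) ^ (1 - γ) := by
      rw [Real.rpow_sub hM0, Real.rpow_one]; ring
    rw [h4, Real.rpow_def_of_pos hM0, Real.rpow_def_of_pos hX0]
    have h5 : 4 * δ * C' = γ - 1 := by rw [hδ]; field_simp
    refine mul_le_mul_of_nonneg_left (Real.exp_le_exp.2 ?_) hα.le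
    have h6 := mul_le_mul_of_nonneg_left h3 (by positivity : 0 ≤ 4 * δ)
    rw [← mul_assoc (4 * δ) C', h5] at h6
    linarith
  have h6 : M * (α / (M : ℝ) ^ γ) * (B * (M / ε) ^ δ) ^ 2 ≤
      D * (M / ε) ^ (-δ) * (M / ε) ^ (-δ) := by
    calc _ ≤ α * (M / ε) ^ (-(4 * δ)) * (B * (M / ε) ^ δ) ^ 2 := by gcongr
      _ = α * B ^ 2 * ((M / ε) ^ (-δ) * (M / ε) ^ (-δ)) := by
        have : (M / ε) ^ (-(4 * δ)) = ((M / ε) ^ (-δ)) ^ 4 := by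
          rw [← Real.rpow_natCast, ← Real.rpow_mul hX0.le]; congr 1; push_cast; ring
        rw [this, Real.rpow_neg hX0.le]
        field_simp
      _ ≤ D * ((M / ε) ^ (-δ) * (M / ε) ^ (-δ)) := by
        gcongr
        exact le_max_right _ _
      _ = _ := by ring
  calc _ ≤ G / g * (D * (M / ε) ^ (-δ) * (M / ε) ^ (-δ)) ^ s := by gcongr
    _ = G / g * (D * (M / ε) ^ (-δ)) ^ s * ((M / ε) ^ (-δ)) ^ s := by ring
    _ ≤ G / g * D ^ (D ^ (1 / δ)) * ((M / ε) ^ (-δ)) ^ s := by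
      gcongr
      exact pow_mul_rpow_neg_le hD1 hδ0 (le_trans (by exact_mod_cast hsM) hX) hX0
    _ = _ := by
      congr 1
      rw [Real.rpow_def_of_pos hX0, ← Real.exp_nat_mul]
      congr 1
      ring

/-! ### Small balls: a box inside the ball -/

lemma lintegral_indicator_rpow_sub_one {ρ d : ℝ} (hρ : 0 < ρ) (hd : 0 < d) :
    ∫⁻ x, (Set.Icc 0 d).indicator (powDensity ρ) x = ENNReal.ofReal (d ^ ρ / ρ) := by
  rw [lintegral_indicator measurableSet_Icc,
    setLIntegral_congr_fun (g := fun x => ENNReal.ofReal (x ^ (ρ - 1))) measurableSet_Icc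
      fun x hx => powDensity_of_nonneg hx.1,
    setLIntegral_congr Ioc_ae_eq_Icc.symm, ← ofReal_integral_eq_lintegral_ofReal,
    ← intervalIntegral.integral_of_le hd.le, integral_rpow (Or.inl (by linarith))]
  · simp [Real.zero_rpow hρ.ne']
  · exact (intervalIntegrable_iff_integrableOn_Ioc_of_le hd.le).1
      (intervalIntegral.intervalIntegrable_rpow' (by linarith))
  · refine (ae_restrict_mem measurableSet_Ioc).mono fun x hx => ?_
    exact Real.rpow_nonneg hx.1.le _

lemma simplexParam_castSucc {n : ℕ} (x : Fin n → ℝ) (j : Fin n) :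
    simplexParam x j.castSucc = x j := by simp [simplexParam]

lemma simplexParam_last {n : ℕ} (x : Fin n → ℝ) :
    simplexParam x (Fin.last n) = 1 - ∑ i, x i := by simp [simplexParam]

lemma simplexParam_last_mem_Icc {n : ℕ} {p : Fin (n + 1) → ℝ} (hp : p ∈ stdSimplex ℝ (Fin (n + 1)))
    {d : ℝ} {x : Fin n → ℝ}
    (hx : ∀ j, x j - p j.castSucc ∈ Set.Icc 0 (2 * d)) :
    simplexParam x (Fin.last n) ∈ Set.Icc (p (Fin.last n) - n * (2 * d)) (p (Fin.last n)) := by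
  have h1 := hp.2
  rw [Fin.sum_univ_castSucc] at h1
  have h2 : ∑ j, (x j - p j.castSucc) ≤ ∑ _j : Fin n, 2 * d :=
    Finset.sum_le_sum fun j _ => (hx j).2
  have h3 : 0 ≤ ∑ j, (x j - p j.castSucc) := Finset.sum_nonneg fun j _ => (hx j).1
  rw [Finset.sum_sub_distrib] at h2 h3
  simp only [Finset.sum_const, Finset.card_univ, Fintype.card_fin, nsmul_eq_mul] at h2
  rw [simplexParam_last]
  constructor <;> linarith

lemma norm_toLp_two_le_of_abs_le {M : ℕ} {v : Fin M → ℝ} {η ε : ℝ} (hv : ∀ j, |v j| ≤ η)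
    (hε : 0 ≤ ε) (h : M * η ^ 2 ≤ ε ^ 2) :
    ‖(WithLp.toLp 2 v : EuclideanSpace ℝ (Fin M))‖ ≤ ε := by
  rw [EuclideanSpace.norm_eq, Real.sqrt_le_left hε]
  refine le_trans ?_ h
  calc ∑ j, ‖v j‖ ^ 2 ≤ ∑ _j : Fin M, η ^ 2 := Finset.sum_le_sum fun j _ =>
        pow_le_pow_left₀ (norm_nonneg _) (hv j) 2
    _ = _ := by simp

/-- A lower bound for the density factor of one coordinate near `c`, supported in `[c, c + 2 * d]`. -/
noncomputable def boxDensity (ρ A d c : ℝ) : ℝ → ENNReal :=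
  if c = 0 then (Set.Icc 0 d).indicator (powDensity ρ)
  else (Set.Icc (c + d) (c + 2 * d)).indicator fun _ => ENNReal.ofReal (d ^ (A - 1))

@[fun_prop]
lemma measurable_boxDensity (ρ A d c : ℝ) : Measurable (boxDensity ρ A d c) := by
  unfold boxDensity
  split_ifs
  · exact (measurable_powDensity ρ).indicator measurableSet_Icc
  · exact measurable_const.indicator measurableSet_Icc

lemma lintegral_boxDensity {ρ A d : ℝ} (c : ℝ) (hρ : 0 < ρ) (hd : 0 < d) :
    ∫⁻ x, boxDensity ρ A d c x =
      if c = 0 then ENNReal.ofReal (d ^ ρ / ρ) else ENNReal.ofReal (d ^ A) := by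
  unfold boxDensity
  split_ifs
  · exact lintegral_indicator_rpow_sub_one hρ hd
  · rw [lintegral_indicator_const measurableSet_Icc, Real.volume_Icc,
      ← ENNReal.ofReal_mul (by positivity), Real.rpow_sub_one hd.ne']
    congr 1
    field_simp
    ring

lemma boxDensity_eq_zero {ρ A d c x : ℝ} (hd : 0 < d) (hx : x - c ∉ Set.Icc 0 (2 * d)) :
    boxDensity ρ A d c x = 0 := by
  unfold boxDensity
  split_ifs with hc
  · subst hc
    refine Set.indicator_of_notMem (fun h => hx ⟨?_, ?_⟩) _ <;> linarith [h.1, h.2]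
  · refine Set.indicator_of_notMem (fun h => hx ⟨?_, ?_⟩) _ <;> linarith [h.1, h.2]

/-- For `c ≠ 0` the box starts at `c + d`, so `x ≥ d` there; since `x ≤ 1`, raising the exponent
from `ρ - 1` to `A - 1 ≥ 0` only lowers the power. This treats `ρ < 1` and `ρ ≥ 1` alike. -/
lemma boxDensity_le_powDensity {ρ A d c x : ℝ} (hd : 0 < d) (hA : 1 ≤ A) (hρA : ρ ≤ A)
    (hc : 0 ≤ c) (hx : x ≤ 1) : boxDensity ρ A d c x ≤ powDensity ρ x := by
  unfold boxDensity
  split_ifs with h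
  · exact Set.indicator_le_self _ _ _
  · by_cases hm : x ∈ Set.Icc (c + d) (c + 2 * d)
    · have hdx : d ≤ x := by linarith [hm.1]
      rw [Set.indicator_of_mem hm, powDensity_of_nonneg (by linarith)]
      refine ENNReal.ofReal_le_ofReal ?_
      calc d ^ (A - 1) ≤ x ^ (A - 1) := Real.rpow_le_rpow hd.le hdx (by linarith)
        _ ≤ x ^ (ρ - 1) := Real.rpow_le_rpow_of_exponent_ge (by linarith) hx (by linarith)
    · rw [Set.indicator_of_notMem hm]
      exact zero_le

lemma measurableSet_norm_toLp_sub_le {M : ℕ} (p : Fin M → ℝ) (ε : ℝ) :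
    MeasurableSet {l | ‖(WithLp.toLp 2 (l - p) : EuclideanSpace ℝ (Fin M))‖ ≤ ε} := by
  have : Continuous fun l : Fin M → ℝ => ‖(WithLp.toLp 2 (l - p) : EuclideanSpace ℝ (Fin M))‖ :=
    ((PiLp.continuous_toLp 2 _).comp (continuous_id.sub continuous_const)).norm
  exact (isClosed_le this continuous_const).measurableSet

/-- The other coordinates move up by at most `2 * d` each, so the last one drops by at most `ε / (2
* M)` with `M = n + 1`. It stays above `1 / (2 * M)`, and every coordinate error is at most `ε / (2
* M)`. -/
lemma le_symmDirichlet_ball_of_last {n : ℕ} {p : Fin (n + 1) → ℝ}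
    (hp : p ∈ stdSimplex ℝ (Fin (n + 1))) (hlast : 1 / ((n + 1 : ℕ) : ℝ) ≤ p (Fin.last n))
    {ρ A ε : ℝ} (hρ : 0 < ρ) (hA : 1 ≤ A) (hρA : ρ ≤ A) (hε : 0 < ε) (hε1 : ε < 1) {d : ℝ}
    (hd : d = ε / (4 * ((n + 1 : ℕ) : ℝ) ^ 2)) :
    ENNReal.ofReal (Real.Gamma ((n + 1 : ℕ) * ρ) / Real.Gamma ρ ^ (n + 1) *
      (2 * ((n + 1 : ℕ) : ℝ)) ^ (-(A - 1)) *
      ∏ j : Fin n, if p j.castSucc = 0 then d ^ ρ / ρ else d ^ A) ≤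
    symmDirichlet (n + 1) ρ
      {l | ‖(WithLp.toLp 2 (l - p) : EuclideanSpace ℝ (Fin (n + 1)))‖ ≤ ε} := by
  have hM0 : (0 : ℝ) < (n + 1 : ℕ) := by positivity
  have hM1 : (1 : ℝ) ≤ (n + 1 : ℕ) := by simp
  have hd0 : 0 < d := by rw [hd]; positivity
  have hMd : ((n + 1 : ℕ) : ℝ) * (2 * d) = ε / (2 * (n + 1 : ℕ)) := by
    rw [hd]; field_simp; ring
  have hnd : (n : ℝ) * (2 * d) ≤ ε / (2 * (n + 1 : ℕ)) := by
    rw [← hMd]; gcongr; simp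
  have hhalf : ε / (2 * ((n + 1 : ℕ) : ℝ)) ≤ 1 / (2 * ((n + 1 : ℕ) : ℝ)) := by gcongr
  have hhalf' : 1 / (2 * ((n + 1 : ℕ) : ℝ)) + 1 / (2 * ((n + 1 : ℕ) : ℝ)) =
    1 / ((n + 1 : ℕ) : ℝ) := by field_simp; norm_num
  have h2d : 2 * d ≤ ε / (2 * (n + 1 : ℕ)) := by rw [← hMd]; nlinarith
  set c := Real.Gamma ((n + 1 : ℕ) * ρ) / Real.Gamma ρ ^ (n + 1) with hc
  have hc0 : 0 < c := div_pos (Real.Gamma_pos_of_pos (by positivity))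
    (pow_pos (Real.Gamma_pos_of_pos hρ) _)
  set W := (2 * ((n + 1 : ℕ) : ℝ)) ^ (-(A - 1)) with hW
  have hW0 : 0 < W := by positivity
  rw [symmDirichlet, dirichletMeasure_apply _ (measurableSet_norm_toLp_sub_le p ε)]
  calc _ = ∫⁻ x : Fin n → ℝ, ENNReal.ofReal (c * W) *
        ∏ j : Fin n, boxDensity ρ A d (p j.castSucc) (x j) := by
        rw [lintegral_const_mul' _ _ ENNReal.ofReal_ne_top, lintegral_fin_prod_eq_prod _
          (fun j => measurable_boxDensity _ _ _ _), ENNReal.ofReal_mul (by positivity),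
          ENNReal.ofReal_prod_of_nonneg]
        · simp only [lintegral_boxDensity _ hρ hd0, apply_ite ENNReal.ofReal]
        · intro j _
          split_ifs <;> positivity
    _ ≤ _ := by
        refine lintegral_mono fun x => ?_
        by_cases hx : ∀ j, x j - p j.castSucc ∈ Set.Icc 0 (2 * d)
        swap
        · push Not at hx
          obtain ⟨j, hj⟩ := hx
          rw [Finset.prod_eq_zero (f := fun j => boxDensity ρ A d (p j.castSucc) (x j))
            (Finset.mem_univ j) (boxDensity_eq_zero hd0 hj), mul_zero]
          exact zero_le
        have hl := simplexParam_last_mem_Icc hp hx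
        have hl1 : 1 / (2 * ((n + 1 : ℕ) : ℝ)) ≤ simplexParam x (Fin.last n) := by
          linarith [hl.1]
        have hl0 : 0 < simplexParam x (Fin.last n) := lt_of_lt_of_le (by positivity) hl1
        have hx0 : ∀ j, 0 ≤ x j := fun j => by linarith [(hx j).1, hp.1 j.castSucc]
        have hx1 : ∀ j, x j ≤ 1 := fun j => by
          rw [simplexParam_last] at hl0
          linarith [Finset.single_le_sum (fun j _ => hx0 j) (Finset.mem_univ j)]
        have hmem : x ∈ simplexParam ⁻¹'
            {l | ‖(WithLp.toLp 2 (l - p) : EuclideanSpace ℝ (Fin (n + 1)))‖ ≤ ε} := by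
          refine norm_toLp_two_le_of_abs_le (η := ε / (2 * ((n + 1 : ℕ) : ℝ))) (fun j => ?_) hε.le ?_
          · refine Fin.lastCases ?_ (fun j => ?_) j
            · rw [Pi.sub_apply, abs_le]
              constructor <;> linarith [hl.1, hl.2, div_pos hε (by positivity : (0 : ℝ) < 2 * (n + 1 : ℕ))]
            · rw [Pi.sub_apply, simplexParam_castSucc, abs_of_nonneg (hx j).1]
              exact (hx j).2.trans h2d
          · have : ((n + 1 : ℕ) : ℝ) * (ε / (2 * ((n + 1 : ℕ) : ℝ))) ^ 2 =
              ε ^ 2 / (4 * ((n + 1 : ℕ) : ℝ)) := by field_simp; norm_num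
            rw [this]
            exact div_le_self (by positivity) (by linarith)
        rw [Set.indicator_of_mem hmem, ofReal_dirichletPDF_simplexParam fun _ => hρ,
          Fin.prod_univ_castSucc (fun j => powDensity ρ (simplexParam x j)),
          ENNReal.ofReal_mul hc0.le, mul_assoc]
        have hcc : Real.Gamma (∑ _j : Fin (n + 1), ρ) / ∏ _j : Fin (n + 1), Real.Gamma ρ = c := by
          simp [hc]
        rw [hcc, mul_comm (ENNReal.ofReal W)]
        gcongr with j
        · rw [simplexParam_castSucc]
          exact boxDensity_le_powDensity hd0 hA hρA (hp.1 _) (hx1 j)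
        · rw [powDensity_of_nonneg hl0.le]
          refine ENNReal.ofReal_le_ofReal ?_
          have hl2 : simplexParam x (Fin.last n) ≤ 1 := by
            rw [simplexParam_last]
            linarith [Finset.sum_nonneg fun j (_ : j ∈ Finset.univ) => hx0 j]
          calc W = (1 / (2 * ((n + 1 : ℕ) : ℝ))) ^ (A - 1) := by
                rw [hW, Real.rpow_neg (by positivity), ← Real.inv_rpow (by positivity), one_div]
            _ ≤ simplexParam x (Fin.last n) ^ (A - 1) :=
                Real.rpow_le_rpow (by positivity) hl1 (by linarith)
            _ ≤ _ := Real.rpow_le_rpow_of_exponent_ge hl0 hl2 (by linarith)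

lemma norm_toLp_two_comp_perm {M : ℕ} (σ : Equiv.Perm (Fin M)) (v : Fin M → ℝ) :
    ‖(WithLp.toLp 2 (v ∘ σ) : EuclideanSpace ℝ (Fin M))‖ =
      ‖(WithLp.toLp 2 v : EuclideanSpace ℝ (Fin M))‖ := by
  rw [EuclideanSpace.norm_eq, EuclideanSpace.norm_eq]
  congr 1
  exact Equiv.sum_comp σ fun j => ‖v j‖ ^ 2

lemma l0norm_comp_perm {M : ℕ} (σ : Equiv.Perm (Fin M)) (v : Fin M → ℝ) :
    l0norm (v ∘ σ) = l0norm v := by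
  have : Function.support (v ∘ σ) = σ ⁻¹' Function.support v := rfl
  rw [l0norm, l0norm, this, Set.ncard_preimage_of_injective_subset_range σ.injective]
  simp

lemma exists_one_div_le_of_mem_stdSimplex {M : ℕ} {p : Fin M → ℝ}
    (hp : p ∈ stdSimplex ℝ (Fin M)) : ∃ k, 1 / (M : ℝ) ≤ p k := by
  by_contra! h
  have hne : (Finset.univ : Finset (Fin M)).Nonempty := by
    by_contra hcon
    rw [Finset.not_nonempty_iff_eq_empty] at hcon
    have := hp.2
    simp [hcon] at this
  have h1 := Finset.sum_lt_sum_of_nonempty hne fun j _ => h j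
  rw [hp.2] at h1
  have hM : (M : ℝ) ≠ 0 := by
    obtain ⟨j, -⟩ := hne
    exact_mod_cast (j.pos).ne'
  simp [hM] at h1

lemma card_filter_ne_zero_add_one {n : ℕ} {p : Fin (n + 1) → ℝ} (hlast : p (Fin.last n) ≠ 0) :
    (Finset.univ.filter fun j : Fin n => p j.castSucc ≠ 0).card + 1 = l0norm p := by
  classical
  have : Function.support p = ((Finset.univ.filter fun j => p j ≠ 0 : Finset (Fin (n + 1))) : Set _) := by
    ext; simp
  rw [l0norm, this, Set.ncard_coe_finset, Finset.card_filter, Finset.card_filter,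
    Fin.sum_univ_castSucc]
  simp [hlast]

lemma le_symmDirichlet_real_ball {M s : ℕ} {p : Fin M → ℝ}
    (hp : p ∈ stdSimplex ℝ (Fin M)) (hs : l0norm p = s)
    {ρ A ε : ℝ} (hρ : 0 < ρ) (hA : 1 ≤ A) (hρA : ρ ≤ A) (hε : 0 < ε) (hε1 : ε < 1) {d : ℝ}
    (hd : d = ε / (4 * (M : ℝ) ^ 2)) : 1 ≤ s ∧ s ≤ M ∧
    Real.Gamma (M * ρ) / Real.Gamma ρ ^ M * (2 * (M : ℝ)) ^ (-(A - 1)) *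
      ((d ^ ρ / ρ) ^ (M - s) * (d ^ A) ^ (s - 1)) ≤
    (symmDirichlet M ρ).real
      {l | ‖(WithLp.toLp 2 (l - p) : EuclideanSpace ℝ (Fin M))‖ ≤ ε} := by
  obtain ⟨k, hk⟩ := exists_one_div_le_of_mem_stdSimplex hp
  obtain ⟨n, rfl⟩ := Nat.exists_eq_succ_of_ne_zero k.pos.ne'
  have hM0 : (0 : ℝ) < (n + 1 : ℕ) := by positivity
  set σ := Equiv.swap k (Fin.last n) with hσ
  have hpσ : p ∘ σ ∈ stdSimplex ℝ (Fin (n + 1)) :=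
    ⟨fun j => hp.1 _, (Equiv.sum_comp σ p).trans hp.2⟩
  have hlast : 1 / ((n + 1 : ℕ) : ℝ) ≤ (p ∘ σ) (Fin.last n) := by simpa [hσ] using hk
  have hlast0 : (p ∘ σ) (Fin.last n) ≠ 0 := (lt_of_lt_of_le (by positivity) hlast).ne'
  have hcard := card_filter_ne_zero_add_one hlast0
  rw [l0norm_comp_perm, hs] at hcard
  have hcard' := Finset.card_filter_add_card_filter_not (s := (Finset.univ : Finset (Fin n)))
    fun j => (p ∘ σ) j.castSucc = 0
  rw [Finset.card_univ, Fintype.card_fin] at hcard'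
  have hle := le_symmDirichlet_ball_of_last hpσ hlast hρ hA hρA hε hε1 hd
  rw [Finset.prod_ite, Finset.prod_const, Finset.prod_const] at hle
  have h1 : (Finset.univ.filter fun j : Fin n => (p ∘ σ) j.castSucc = 0).card = n + 1 - s := by
    simp only [ne_eq] at hcard
    omega
  have h2 : (Finset.univ.filter fun j : Fin n => ¬ (p ∘ σ) j.castSucc = 0).card = s - 1 := by
    simp only [ne_eq] at hcard
    omega
  rw [h1, h2, ← symmDirichlet_preimage_swap_last ρ k (measurableSet_norm_toLp_sub_le _ _)] at hle
  have hset : (fun l : Fin (n + 1) → ℝ => l ∘ Equiv.swap k (Fin.last n)) ⁻¹'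
      {l | ‖(WithLp.toLp 2 (l - p ∘ σ) : EuclideanSpace ℝ (Fin (n + 1)))‖ ≤ ε} =
      {l | ‖(WithLp.toLp 2 (l - p) : EuclideanSpace ℝ (Fin (n + 1)))‖ ≤ ε} := by
    ext l
    have : l ∘ Equiv.swap k (Fin.last n) - p ∘ σ = (l - p) ∘ σ := rfl
    simp only [Set.mem_preimage, Set.mem_ofPred_eq, this, norm_toLp_two_comp_perm]
  rw [hset] at hle
  refine ⟨by omega, by omega, ?_⟩
  rw [measureReal_def]
  refine (ENNReal.ofReal_le_iff_le_toReal ?_).1 hle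
  exact ne_top_of_le_ne_top ENNReal.one_ne_top
    ((measure_mono (Set.subset_univ _)).trans (dirichletMeasure_univ_le_one fun _ => hρ))

/-! ### Constants in the small-ball bound -/

/-- Log-convexity between `1` and `A + 1` gives `Γ(ρ + 1) ≤ H ^ (ρ / A)`, and `M * ρ / A ≤ 1`: the
bound does not grow with `M`. -/
lemma Gamma_one_add_pow_le {ρ A : ℝ} {M : ℕ} (hρ : 0 < ρ) (hA : 0 < A) (hM : 1 ≤ M)
    (hMρ : M * ρ ≤ A) :
    Real.Gamma (ρ + 1) ^ M ≤ max 1 (Real.Gamma (A + 1)) := by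
  set H := max 1 (Real.Gamma (A + 1))
  have hH1 : 1 ≤ H := le_max_left _ _
  have hHA : Real.Gamma (A + 1) ≤ H := le_max_right _ _
  have hM1 : (1 : ℝ) ≤ M := by exact_mod_cast hM
  have hθ : 0 < ρ / A := by positivity
  have h : Real.Gamma (ρ + 1) ≤ H ^ (ρ / A) := by
    rcases lt_or_ge (ρ / A) 1 with h1 | h1
    · have h2 := Real.Gamma_mul_add_mul_le_rpow_Gamma_mul_rpow_Gamma (s := A + 1) (t := 1)
        (by linarith) one_pos hθ (sub_pos.2 h1) (by ring)
      have h3 : ρ / A * (A + 1) + (1 - ρ / A) * 1 = ρ + 1 := by field_simp; ring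
      rw [h3, Real.Gamma_one, Real.one_rpow, mul_one] at h2
      exact h2.trans (Real.rpow_le_rpow (Real.Gamma_pos_of_pos (by linarith)).le hHA hθ.le)
    · rw [one_le_div hA] at h1
      have : ρ = A := le_antisymm (by nlinarith) h1
      subst this
      rwa [div_self hρ.ne', Real.rpow_one]
  calc _ ≤ (H ^ (ρ / A)) ^ M :=
        pow_le_pow_left₀ (Real.Gamma_pos_of_pos (by linarith)).le h M
    _ = H ^ (ρ / A * M) := by rw [Real.rpow_mul (by linarith), Real.rpow_natCast]
    _ ≤ H ^ (1 : ℝ) := by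
        refine Real.rpow_le_rpow_of_exponent_le hH1 ?_
        rw [div_mul_eq_mul_div, div_le_one hA]
        linarith
    _ = H := Real.rpow_one _

lemma Gamma_div_mul_eq {M s : ℕ} (hs : 1 ≤ s) (hsM : s ≤ M) {ρ D E W : ℝ} (hρ : 0 < ρ) :
    Real.Gamma (M * ρ) / Real.Gamma ρ ^ M * W * ((D / ρ) ^ (M - s) * E ^ (s - 1)) =
      Real.Gamma (M * ρ + 1) / Real.Gamma (ρ + 1) ^ M * (1 / M) * W *
        D ^ (M - s) * (ρ * E) ^ (s - 1) := by
  obtain ⟨k, rfl⟩ := Nat.exists_eq_add_of_le' hs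
  obtain ⟨m, rfl⟩ := Nat.exists_eq_add_of_le' hsM
  have hM0 : (0 : ℝ) < (m + (k + 1) : ℕ) := by positivity
  have hG := Real.Gamma_pos_of_pos hρ
  rw [Real.Gamma_add_one (by positivity), Real.Gamma_add_one hρ.ne', Nat.add_sub_cancel,
    Nat.add_sub_cancel, div_pow]
  field_simp
  ring

theorem exists_le_symmDirichlet_ball {α : ℝ} (hα : 0 < α) : ∃ C : ℝ, 0 < C ∧ ∃ c : ℝ, 0 < c ∧
      ∀ γ : ℝ, 1 < γ → ∀ (M s : ℕ) (lstar : Fin M → ℝ),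
        lstar ∈ stdSimplex ℝ (Fin M) → l0norm lstar = s →
        ∀ ε : ℝ, 0 < ε → ε < 1 →
          c * Real.exp (-(C * γ * s * Real.log (M / ε))) ≤
            (symmDirichlet M (α / (M : ℝ) ^ γ)).real
              {l | ‖(WithLp.toLp 2 (l - lstar) : EuclideanSpace ℝ (Fin M))‖ ≤ ε} := by
  obtain ⟨g, hg, hΓ⟩ := exists_pos_forall_le_Gamma
  have hl2 : 0 < Real.log 2 := Real.log_pos (by norm_num)
  set A := max α 1 with hA
  have hA1 : 1 ≤ A := le_max_right _ _
  have hAα : α ≤ A := le_max_left _ _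
  -- Chosen so that `α ≥ 2 ^ (-q)`: a small `α` is paid for by powers of `M / ε` once `M ≥ 2`.
  set q := max 0 (-Real.log α / Real.log 2) with hq
  have hq0 : 0 ≤ q := le_max_left _ _
  have hqα : -(q * Real.log 2) ≤ Real.log α := by
    have : -Real.log α / Real.log 2 ≤ q := le_max_right _ _
    rw [div_le_iff₀ hl2] at this
    linarith
  set H := max 1 (Real.Gamma (A + 1)) with hH
  have hH0 : 0 < H := lt_max_of_lt_left one_pos
  refine ⟨q + 2 + 5 * A + 2 * α, by positivity,
    g / H * Real.exp (-(A * Real.log 2 + α * Real.log 4)), by positivity,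
    fun γ hγ M s p hp hs ε hε hε1 => ?_⟩
  have hM : 1 ≤ M := by
    obtain ⟨k, -⟩ := exists_one_div_le_of_mem_stdSimplex hp
    exact k.pos
  have hM0 : (0 : ℝ) < M := by exact_mod_cast hM
  have hM1 : (1 : ℝ) ≤ M := by exact_mod_cast hM
  obtain ⟨hρ, hρα, hMρ⟩ := div_rpow_pos_and_le hα hγ hM
  obtain ⟨hs1, hsM, hle⟩ := le_symmDirichlet_real_ball hp hs hρ hA1 (hρα.trans hAα) hε hε1 rfl
  refine le_trans ?_ hle
  rw [Gamma_div_mul_eq hs1 hsM hρ]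
  set d := ε / (4 * (M : ℝ) ^ 2) with hd
  set ρ := α / (M : ℝ) ^ γ with hρ_def
  set L := Real.log (M / ε) with hL
  have hd0 : 0 < d := by positivity
  have hL_eq : L = Real.log M - Real.log ε := Real.log_div hM0.ne' hε.ne'
  have hlogε : Real.log ε ≤ 0 := Real.log_nonpos hε.le hε1.le
  have hlogM : 0 ≤ Real.log M := Real.log_nonneg hM1
  have hL0 : 0 ≤ L := by linarith
  have hlog4 : 0 < Real.log 4 := Real.log_pos (by norm_num)
  have hlogd : -(Real.log 4 + 2 * L) ≤ Real.log d := by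
    rw [hd, Real.log_div hε.ne' (by positivity), Real.log_mul (by norm_num) (by positivity),
      Real.log_pow]
    push_cast
    linarith
  have hlogd0 : Real.log d ≤ 0 := by
    rw [hd, Real.log_div hε.ne' (by positivity), Real.log_mul (by norm_num) (by positivity),
      Real.log_pow]
    push_cast
    linarith
  have h1 : g / H ≤ Real.Gamma (M * ρ + 1) / Real.Gamma (ρ + 1) ^ M := by
    have := Real.Gamma_pos_of_pos (by linarith : 0 < ρ + 1)
    gcongr
    · exact hΓ _ (by positivity)
    · exact Gamma_one_add_pow_le hρ (by linarith) hM (by linarith)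
  have h2 : Real.exp (-L) ≤ 1 / (M : ℝ) := by
    rw [← Real.exp_log (by positivity : 0 < 1 / (M : ℝ)), one_div, Real.log_inv]
    exact Real.exp_le_exp.2 (by linarith)
  have h3 : Real.exp (-(A * (Real.log 2 + L))) ≤ (2 * (M : ℝ)) ^ (-(A - 1)) := by
    rw [Real.rpow_def_of_pos (by positivity), Real.log_mul (by norm_num) hM0.ne']
    refine Real.exp_le_exp.2 ?_
    nlinarith
  have h4 : Real.exp (-(α * (Real.log 4 + 2 * L))) ≤ (d ^ ρ) ^ (M - s) := by
    rw [Real.rpow_def_of_pos hd0, ← Real.exp_nat_mul]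
    refine Real.exp_le_exp.2 ?_
    have h5 : ((M - s : ℕ) : ℝ) * ρ ≤ α :=
      le_trans (by gcongr; omega) hMρ
    nlinarith
  have h6 : Real.exp (-((q + γ + 4 * A) * L)) ^ (s - 1) ≤ (ρ * d ^ A) ^ (s - 1) := by
    -- If `s = 1` nothing is to be paid; otherwise `M ≥ 2`, and `log 2 ≤ L` absorbs `α` and the `4`
    -- in `d`.
    rcases Nat.eq_zero_or_pos (s - 1) with h0 | h0
    · rw [h0, pow_zero, pow_zero]
    · have hM2 : (2 : ℝ) ≤ M := by exact_mod_cast (by omega : 2 ≤ M)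
      have hL2 : Real.log 2 ≤ L := by linarith [Real.log_le_log (by norm_num) hM2]
      have h42 : Real.log 4 = 2 * Real.log 2 := by
        rw [show (4 : ℝ) = 2 ^ 2 by norm_num, Real.log_pow]; norm_num
      refine pow_le_pow_left₀ (Real.exp_pos _).le ?_ _
      rw [← Real.exp_log hρ, Real.rpow_def_of_pos hd0, ← Real.exp_add]
      refine Real.exp_le_exp.2 ?_
      rw [hρ_def, Real.log_div hα.ne' (by positivity), Real.log_rpow hM0]
      have h7 : -(q * L) ≤ Real.log α := by nlinarith
      have h8 : γ * Real.log M ≤ γ * L := by gcongr; linarith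
      have h9 : -(4 * L) * A ≤ Real.log d * A := by gcongr; linarith
      linarith
  have h10 : (1 : ℝ) ≤ s := by exact_mod_cast hs1
  calc g / H * Real.exp (-(A * Real.log 2 + α * Real.log 4)) *
        Real.exp (-((q + 2 + 5 * A + 2 * α) * γ * s * L))
      ≤ g / H * Real.exp (-L) * Real.exp (-(A * (Real.log 2 + L))) *
        Real.exp (-(α * (Real.log 4 + 2 * L))) * Real.exp (-((q + γ + 4 * A) * L)) ^ (s - 1) := by
        rw [← Real.exp_nat_mul, mul_assoc, mul_assoc (g / H), mul_assoc (g / H),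
          mul_assoc (g / H), ← Real.exp_add, ← Real.exp_add, ← Real.exp_add, ← Real.exp_add]
        refine mul_le_mul_of_nonneg_left (Real.exp_le_exp.2 ?_) (by positivity)
        rw [Nat.cast_sub hs1, Nat.cast_one]
        have e1 : (q + γ + 4 * A) * (s - 1) ≤ (q + 1 + 4 * A) * γ * (s - 1) := by
          gcongr
          linarith [mul_nonneg (by positivity : 0 ≤ q + 4 * A) (sub_nonneg.2 hγ.le)]
        have e2 : 1 + A + 2 * α ≤ (1 + A + 2 * α) * γ * s := by
          have : 1 ≤ γ * s := one_le_mul_of_one_le_of_one_le hγ.le h10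
          rw [mul_assoc]
          exact le_mul_of_one_le_right (by positivity) this
        have e3 : (q + 1 + 4 * A) * γ * (s - 1) ≤ (q + 1 + 4 * A) * γ * s := by
          gcongr
          linarith
        have e4 := mul_le_mul_of_nonneg_right (e1.trans e3) hL0
        have e5 := mul_le_mul_of_nonneg_right e2 hL0
        linarith
    _ ≤ _ := by gcongr

theorem theorem1 :
    (∀ α : ℝ, 0 < α → ∃ C : ℝ, 0 < C ∧ ∃ c : ℝ, 0 < c ∧
      ∀ γ : ℝ, 1 < γ → ∀ (M s : ℕ) (lstar : Fin M → ℝ),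
        lstar ∈ stdSimplex ℝ (Fin M) → l0norm lstar = s →
        ∀ ε : ℝ, 0 < ε → ε < 1 →
          c * Real.exp (-(C * γ * s * Real.log (M / ε))) ≤
            (symmDirichlet M (α / (M : ℝ) ^ γ)).real
              {l | ‖(WithLp.toLp 2 (l - lstar) : EuclideanSpace ℝ (Fin M))‖ ≤ ε}) ∧
    (∀ ε₀ : ℝ, 0 < ε₀ → ε₀ < 1 → ∀ κ : ℝ, 0 ≤ κ → ∃ C : ℝ, 0 < C ∧
      ∀ α : ℝ, 0 < α → ∀ γ : ℝ, 1 < γ → ∃ K : ℝ, 0 < K ∧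
        ∀ M s : ℕ, 1 ≤ s → s ≤ M →
        ∀ ε : ℝ, ε₀ * (M : ℝ) ^ (-κ) ≤ ε → ε < 1 →
          (symmDirichlet M (α / (M : ℝ) ^ γ)).real {l | l ∉ approxSparse M s ε} ≤
            K * Real.exp (-(C * (γ - 1) * s * Real.log (M / ε)))) :=
  ⟨fun _ hα => exists_le_symmDirichlet_ball hα,
    fun _ hε₀ hε₀1 _ hκ => symmDirichlet_not_mem_approxSparse_le hε₀ hε₀1 hκ⟩
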